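/- Recall the following notions. A Gromov-hyperbolic space is a geodesic metric space $X$ for which there is $\delta\ge 0$ such that every side of every geodesic triangle lies in the $\delta$-neighbourhood of the union of the other two sides. Write $(x\cdot y)_{o}=\frac12\big(d(o,x)+d(o,y)-d(x,y)\big)$. The Gromov boundary $\partial X$ is the set of sequences $(x_n)$ in $X$ with $(x_i\cdot x_j)_{o}\to\infty$ as $i,j\to\infty$, modulo the relation $(x_n)\sim(y_n)$ iff $(x_i\cdot y_j)_{o}\to\infty$ as $i,j\to\infty$ (these notions do not depend on the base point $o\in X$). A group $G$ acting on $X$ by isometries acts on $\partial X$ by $g\cdot[(x_n)]=[(g x_n)]$, and its limit set $\Lambda(G)\subseteq\partial X$ is the set of boundary points represented by a sequence $(g_n o)$ with $g_n\in G$. The action is lineal if $|\Lambda(G)|=2$, and focal if $\Lambda(G)$ is infinite and $G$ fixes a point of $\partial X$. An element $g\in G$ is hyperbolic on $X$ if the orbits of $\langle g\rangle$ in $X$ are unbounded and $g$ has exactly two fixed points in $\partial X$. **Proposition.** Let $G$ be a group acting by isometries on finitely many Gromov-hyperbolic spaces $X_1,\dots,X_l$ such that, for each $i$, the action of $G$ on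 $X_i$ is lineal or focal. Then there is an element $g\in G$ that is hyperbolic on $X_i$ for every $1\le i\le l$; that is, $$\mathcal{SH}(G)=\{g\in G: g\text{ is hyperbolic on each }X_i,\ 1\le i\le l\}\neq\varnothing .$$ -/

import Mathlib

open Filter Set

/-- `s` is (the image of) a geodesic segment from `x` to `y`: the image of an isometric embedding
of an interval `[0, L]` which sends `0` to `x` and `L` to `y`. -/
def IsGeodesicSegment {X : Type*} [MetricSpace X] (x y : X) (s : Set X) : Prop :=
  ∃ (L : ℝ) (γ : ℝ → X), 0 ≤ L ∧ γ 0 = x ∧ γ L = y ∧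
    (∀ a ∈ Icc (0 : ℝ) L, ∀ b ∈ Icc (0 : ℝ) L, dist (γ a) (γ b) = |a - b|) ∧
    s = γ '' Icc (0 : ℝ) L

/-- Any two points can be connected by a geodesic. -/
def IsGeodesicSpace (X : Type*) [MetricSpace X] : Prop :=
  ∀ x y : X, ∃ s : Set X, IsGeodesicSegment x y s

/-- Every geodesic triangle is `δ`-thin: each side lies in the `δ`-neighbourhood of the union of
the two others. (All vertices are quantified over and segments can be reversed, so that it is
enough to mention one of the sides.) -/
def HasThinTriangles (X : Type*) [MetricSpace X] (δ : ℝ) : Prop :=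
  ∀ (x y z : X) (a b c : Set X),
    IsGeodesicSegment x y a → IsGeodesicSegment y z b → IsGeodesicSegment z x c →
      ∀ p ∈ a, ∃ q ∈ b ∪ c, dist p q ≤ δ

/-- Gromov-hyperbolic spaces: geodesic metric spaces with `δ`-thin triangles for some `δ ≥ 0`. -/
def IsGromovHyperbolic (X : Type*) [MetricSpace X] : Prop :=
  IsGeodesicSpace X ∧ ∃ δ : ℝ, 0 ≤ δ ∧ HasThinTriangles X δ

/-- The Gromov product `(x · y)_o`. -/
noncomputable def gromovProduct {X : Type*} [MetricSpace X] (o x y : X) : ℝ :=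
  (dist o x + dist o y - dist x y) / 2

/-- `(x_i · y_j)_o → ∞` as `i, j → ∞`. Changing the base point changes Gromov products by a
bounded amount, so this does not depend on `o`, and all base points are allowed. -/
def GromovEquiv {X : Type*} [MetricSpace X] (x y : ℕ → X) : Prop :=
  ∀ o : X, Tendsto (fun p : ℕ × ℕ => gromovProduct o (x p.1) (y p.2)) atTop atTop

/-- The sequence `x` converges at infinity: `(x_i · x_j)_o → ∞` as `i, j → ∞`. -/
def ConvergesAtInfinity {X : Type*} [MetricSpace X] (x : ℕ → X) : Prop :=
  GromovEquiv x x

/-- The Gromov boundary `∂X`: sequences converging at infinity, modulo `GromovEquiv` (which is an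
equivalence relation on such sequences when `X` is Gromov-hyperbolic). -/
def GromovBoundary (X : Type*) [MetricSpace X] : Type _ :=
  Quot fun x y : {u : ℕ → X // ConvergesAtInfinity u} => GromovEquiv x.1 y.1

theorem gromovProduct_smul {G X : Type*} [Group G] [MetricSpace X] [MulAction G X]
    [IsIsometricSMul G X] (g : G) (o x y : X) :
    gromovProduct o (g • x) (g • y) = gromovProduct (g⁻¹ • o) x y := by
  have h : ∀ z : X, dist o (g • z) = dist (g⁻¹ • o) z := fun z => by
    rw [← dist_smul g (g⁻¹ • o) z, smul_inv_smul]
  simp only [gromovProduct, h, dist_smul]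

theorem GromovEquiv.smul {G X : Type*} [Group G] [MetricSpace X] [MulAction G X]
    [IsIsometricSMul G X] (g : G) {x y : ℕ → X} (h : GromovEquiv x y) :
    GromovEquiv (fun n => g • x n) (fun n => g • y n) := fun o => by
  simpa only [gromovProduct_smul] using h (g⁻¹ • o)

/-- The action `g • [(x_n)] = [(g • x_n)]` on the Gromov boundary induced by an isometric
action. -/
instance GromovBoundary.instMulAction {G X : Type*} [Group G] [MetricSpace X] [MulAction G X]
    [IsIsometricSMul G X] : MulAction G (GromovBoundary X) where
  smul g := Quot.map (fun x => ⟨fun n => g • x.1 n, GromovEquiv.smul g x.2⟩)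
    fun _ _ h => GromovEquiv.smul g h
  one_smul ξ := by
    induction ξ using Quot.ind with
    | _ x => exact congrArg (Quot.mk _) (Subtype.ext (funext fun n => one_smul G (x.1 n)))
  mul_smul g h ξ := by
    induction ξ using Quot.ind with
    | _ x => exact congrArg (Quot.mk _) (Subtype.ext (funext fun n => mul_smul g h (x.1 n)))

/-- The limit set `Λ(G) ⊆ ∂X`: the boundary points represented by a sequence in an orbit of `G`.
(Two orbits of `G` have the same limit points, so the base point `o` does not matter.) -/
def limitSet (G X : Type*) [Group G] [MetricSpace X] [MulAction G X] :
    Set (GromovBoundary X) :=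
  {ξ | ∃ (o : X) (u : ℕ → G) (h : ConvergesAtInfinity fun n => u n • o),
    ξ = Quot.mk _ ⟨fun n => u n • o, h⟩}

/-- `g` is elliptic on `X`: the orbits of the cyclic group generated by `g` are bounded. -/
def IsEllipticElement {G : Type*} (X : Type*) [Group G] [MetricSpace X] [MulAction G X]
    (g : G) : Prop :=
  ∀ x : X, Bornology.IsBounded (MulAction.orbit (Subgroup.zpowers g) x)

/-- `g` is hyperbolic on `X`: it is not elliptic and has exactly two fixed points in `∂X`. -/
def IsHyperbolicElement {G : Type*} (X : Type*) [Group G] [MetricSpace X] [MulAction G X]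
    [IsIsometricSMul G X] (g : G) : Prop :=
  ¬ IsEllipticElement X g ∧ (MulAction.fixedBy (GromovBoundary X) g).encard = 2

/-- The action of `G` on `X` is lineal: `|Λ(G)| = 2`. -/
def IsLinealAction (G X : Type*) [Group G] [MetricSpace X] [MulAction G X] : Prop :=
  (limitSet G X).encard = 2

/-- The action of `G` on `X` is focal (quasi-parabolic): `|Λ(G)| = ∞` and `G` fixes a point of
`∂X`. -/
def IsFocalAction (G X : Type*) [Group G] [MetricSpace X] [MulAction G X]
    [IsIsometricSMul G X] : Prop :=
  (limitSet G X).Infinite ∧ (MulAction.fixedPoints G (GromovBoundary X)).Nonempty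

/-- `SH(G)`: the elements of `G` that are hyperbolic on every `X i`. -/
def simultaneouslyHyperbolic (G : Type*) {ι : Type*} (X : ι → Type*) [Group G]
    [∀ i, MetricSpace (X i)] [∀ i, MulAction G (X i)] [∀ i, IsIsometricSMul G (X i)] : Set G :=
  {g | ∀ i, IsHyperbolicElement (X i) g}

/-! In each `X i` some boundary point `ξ i` has a finite orbit: one of the two limit points in the
lineal case, the global fixed point in the focal case. The intersection `H` of the stabilizers of
all the `ξ i` therefore has finite index.

On `H`, the Busemann function of `ξ i` evaluated along an orbit is a quasimorphism. It is unbounded,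
since a second limit point exists and finite index subgroups have coarsely the same orbits
(`IsBusemann.exists_lt_abs`). An element on which it is large drifts linearly towards or away from
`ξ i`, and so is hyperbolic (`IsBusemann.isHyperbolicElement`).

It remains to find one element at which finitely many unbounded quasimorphisms are all large. This
is pure group theory: `exists_forall_lt_abs` treats them one at a time, using that a value above the
defect grows linearly along powers. -/

/-! ### Geodesic triangles and the four-point condition -/

theorem IsGeodesicSegment.symm {X : Type*} [MetricSpace X] {x y : X} {s : Set X}
    (h : IsGeodesicSegment x y s) : IsGeodesicSegment y x s := by
  obtain ⟨L, γ, hL, h0, h1, hd, rfl⟩ := h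
  refine ⟨L, fun t => γ (L - t), hL, by simpa using h1, by simpa using h0, ?_, ?_⟩
  · intro a ha b hb
    rw [hd _ ⟨by linarith [ha.2], by linarith [ha.1]⟩ _ ⟨by linarith [hb.2], by linarith [hb.1]⟩,
      abs_sub_comm a b]
    congr 1
    ring
  · ext p
    constructor
    · rintro ⟨t, ht, rfl⟩
      exact ⟨L - t, ⟨by linarith [ht.2], by linarith [ht.1]⟩, by simp⟩
    · rintro ⟨t, ht, rfl⟩
      exact ⟨L - t, ⟨by linarith [ht.2], by linarith [ht.1]⟩, rfl⟩

theorem IsGeodesicSegment.dist_add_dist {X : Type*} [MetricSpace X] {x y p : X} {s : Set X}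
    (h : IsGeodesicSegment x y s) (hp : p ∈ s) : dist x p + dist p y = dist x y := by
  obtain ⟨L, γ, hL, rfl, rfl, hd, rfl⟩ := h
  obtain ⟨t, ht, rfl⟩ := hp
  have h0 : (0 : ℝ) ∈ Icc 0 L := ⟨le_rfl, hL⟩
  have h1 : L ∈ Icc 0 L := ⟨hL, le_rfl⟩
  rw [hd _ h0 _ ht, hd _ ht _ h1, hd _ h0 _ h1, abs_of_nonpos (by linarith [ht.1]),
    abs_of_nonpos (by linarith [ht.2]), abs_of_nonpos (by linarith)]
  ring

theorem IsGeodesicSegment.left_mem {X : Type*} [MetricSpace X] {x y : X} {s : Set X}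
    (h : IsGeodesicSegment x y s) : x ∈ s := by
  obtain ⟨L, γ, hL, rfl, rfl, hd, rfl⟩ := h
  exact ⟨0, ⟨le_rfl, hL⟩, rfl⟩

theorem IsGeodesicSegment.isPreconnected {X : Type*} [MetricSpace X] {x y : X} {s : Set X}
    (h : IsGeodesicSegment x y s) : IsPreconnected s := by
  obtain ⟨L, γ, hL, rfl, rfl, hd, rfl⟩ := h
  refine isPreconnected_Icc.image γ ?_
  have : LipschitzOnWith 1 γ (Icc 0 L) := LipschitzOnWith.of_dist_le_mul fun a ha b hb => by
    simp [hd a ha b hb, Real.dist_eq]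
  exact this.continuousOn

/-- The four-point condition for Gromov products. -/
def FourPointCondition (X : Type*) [MetricSpace X] (δ : ℝ) : Prop :=
  ∀ o x y z : X, min (gromovProduct o x y) (gromovProduct o y z) ≤ gromovProduct o x z + δ

theorem IsGeodesicSegment.gromovProduct_le {X : Type*} [MetricSpace X] {x y p : X} {s : Set X}
    (h : IsGeodesicSegment x y s) (hp : p ∈ s) (o : X) : gromovProduct o x y ≤ dist o p := by
  have h1 := h.dist_add_dist hp
  have h2 := dist_triangle o p x
  have h3 := dist_triangle o p y
  rw [dist_comm p x] at h2
  unfold gromovProduct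
  linarith

/-- The closed `δ`-neighbourhoods of the other two sides of the triangle on `o`, `x`, `y` cover the
connected segment `s`, and each meets it, so some point of `s` lies in both. Infima of distances
need not be attained, hence `δ + 1`. -/
theorem HasThinTriangles.exists_dist_le {X : Type*} [MetricSpace X] {δ : ℝ}
    (hX : IsGeodesicSpace X) (hδ : 0 ≤ δ) (h : HasThinTriangles X δ) (o : X) {x y : X} {s : Set X}
    (hs : IsGeodesicSegment x y s) :
    ∃ p ∈ s, dist o p ≤ gromovProduct o x y + 2 * (δ + 1) := by
  obtain ⟨b, hb⟩ := hX y o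
  obtain ⟨c, hc⟩ := hX o x
  have hcl : ∀ t : Set X, IsClosed {p : X | Metric.infDist p t ≤ δ} := fun t =>
    isClosed_le (Metric.continuous_infDist_pt t) continuous_const
  have hcov : s ⊆ {p | Metric.infDist p b ≤ δ} ∪ {p | Metric.infDist p c ≤ δ} := by
    intro p hp
    obtain ⟨q, hq, hpq⟩ := h x y o s b c hs hb hc p hp
    rcases hq with hq | hq
    · exact Or.inl ((Metric.infDist_le_dist_of_mem hq).trans hpq)
    · exact Or.inr ((Metric.infDist_le_dist_of_mem hq).trans hpq)
  obtain ⟨p, hp, hpb, hpc⟩ := (isPreconnected_closed_iff.1 hs.isPreconnected) _ _ (hcl b) (hcl c)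
    hcov ⟨y, hs.symm.left_mem, by simpa [Metric.infDist_zero_of_mem hb.left_mem] using hδ⟩
    ⟨x, hs.left_mem, by simpa [Metric.infDist_zero_of_mem hc.symm.left_mem] using hδ⟩
  obtain ⟨q, hq, hpq⟩ := (Metric.infDist_lt_iff ⟨y, hb.left_mem⟩).1
    (lt_of_le_of_lt hpb (lt_add_one δ))
  obtain ⟨r, hr, hpr⟩ := (Metric.infDist_lt_iff ⟨o, hc.left_mem⟩).1
    (lt_of_le_of_lt hpc (lt_add_one δ))
  refine ⟨p, hp, ?_⟩
  have h1 := hs.dist_add_dist hp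
  have h2 := hb.dist_add_dist hq
  have h3 := hc.dist_add_dist hr
  have h4 := dist_triangle y q p
  have h5 := dist_triangle o q p
  have h6 := dist_triangle o r p
  have h7 := dist_triangle x r p
  simp only [dist_comm q, dist_comm r p, dist_comm y o, dist_comm p y, dist_comm x r] at *
  unfold gromovProduct
  linarith

theorem IsGromovHyperbolic.exists_fourPointCondition {X : Type*} [MetricSpace X]
    (hX : IsGromovHyperbolic X) : ∃ δ : ℝ, 0 ≤ δ ∧ FourPointCondition X δ := by
  obtain ⟨hgeo, δ, hδ, h⟩ := hX
  -- The constant is `2 * (δ + 1)` for the point `p` of `[x, z]` near `o`, plus `δ` to reach one of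
  -- the other sides.
  refine ⟨3 * δ + 2, by linarith, fun o x y z => ?_⟩
  obtain ⟨a, ha⟩ := hgeo x z
  obtain ⟨b, hb⟩ := hgeo z y
  obtain ⟨c, hc⟩ := hgeo y x
  obtain ⟨p, hp, hop⟩ := h.exists_dist_le hgeo hδ o ha
  obtain ⟨q, hq, hpq⟩ := h x z y a b c ha hb hc p hp
  have := dist_triangle o p q
  rcases hq with hq | hq
  · refine (min_le_right _ _).trans ?_
    linarith [hb.symm.gromovProduct_le hq o]
  · refine (min_le_left _ _).trans ?_
    linarith [hc.symm.gromovProduct_le hq o]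

/-! ### Gromov products and the boundary -/

theorem gromovProduct_comm {X : Type*} [MetricSpace X] (o x y : X) :
    gromovProduct o x y = gromovProduct o y x := by
  simp only [gromovProduct, dist_comm x y]
  ring

theorem gromovProduct_le_dist {X : Type*} [MetricSpace X] (o x y : X) :
    gromovProduct o x y ≤ dist o x := by
  have := dist_triangle o x y
  unfold gromovProduct
  linarith

theorem gromovEquiv_iff {X : Type*} [MetricSpace X] {x y : ℕ → X} :
    GromovEquiv x y ↔
      ∀ (o : X) (M : ℝ), ∃ N, ∀ i ≥ N, ∀ j ≥ N, M ≤ gromovProduct o (x i) (y j) := by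
  refine forall_congr' fun o => ?_
  rw [tendsto_atTop]
  refine forall_congr' fun M => ?_
  rw [eventually_atTop]
  constructor
  · rintro ⟨⟨a, b⟩, h⟩
    exact ⟨max a b, fun i hi j hj =>
      h (i, j) ⟨(le_max_left _ _).trans hi, (le_max_right _ _).trans hj⟩⟩
  · rintro ⟨N, h⟩
    exact ⟨(N, N), fun p hp => h _ hp.1 _ hp.2⟩

theorem abs_gromovProduct_sub_le {X : Type*} [MetricSpace X] (o o' x y : X) :
    |gromovProduct o x y - gromovProduct o' x y| ≤ dist o o' := by
  have h1 := abs_dist_sub_le o o' x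
  have h2 := abs_dist_sub_le o o' y
  rw [abs_le] at *
  unfold gromovProduct
  constructor <;> linarith

theorem gromovEquiv_of_forall {X : Type*} [MetricSpace X] (o : X) {x y : ℕ → X}
    (h : ∀ M : ℝ, ∃ N, ∀ i ≥ N, ∀ j ≥ N, M ≤ gromovProduct o (x i) (y j)) : GromovEquiv x y := by
  rw [gromovEquiv_iff]
  intro o' M
  obtain ⟨N, hN⟩ := h (M + dist o o')
  refine ⟨N, fun i hi j hj => ?_⟩
  have := (abs_le.1 (abs_gromovProduct_sub_le o o' (x i) (y j))).2
  linarith [hN i hi j hj]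

theorem GromovEquiv.symm {X : Type*} [MetricSpace X] {x y : ℕ → X} (h : GromovEquiv x y) :
    GromovEquiv y x := by
  rw [gromovEquiv_iff] at *
  intro o M
  obtain ⟨N, hN⟩ := h o M
  exact ⟨N, fun i hi j hj => by rw [gromovProduct_comm]; exact hN j hj i hi⟩

theorem FourPointCondition.le_add {X : Type*} [MetricSpace X] {δ : ℝ}
    (hδ : FourPointCondition X δ) {o x y z : X} {M : ℝ} (h1 : M ≤ gromovProduct o x y)
    (h2 : M ≤ gromovProduct o y z) : M ≤ gromovProduct o x z + δ :=
  (le_min h1 h2).trans (hδ o x y z)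

theorem GromovEquiv.trans {X : Type*} [MetricSpace X] {δ : ℝ} (hδ : FourPointCondition X δ)
    {x y z : ℕ → X} (h : GromovEquiv x y) (h' : GromovEquiv y z) : GromovEquiv x z := by
  rw [gromovEquiv_iff] at *
  intro o M
  obtain ⟨N, hN⟩ := h o (M + δ)
  obtain ⟨N', hN'⟩ := h' o (M + δ)
  refine ⟨max N N', fun i hi j hj => ?_⟩
  have := hδ.le_add (hN i ((le_max_left _ _).trans hi) _ (le_max_left N N'))
    (hN' _ (le_max_right N N') j ((le_max_right _ _).trans hj))
  linarith

/-- The boundary point represented by a sequence converging at infinity. -/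
def GromovBoundary.mk {X : Type*} [MetricSpace X] (x : ℕ → X) (hx : ConvergesAtInfinity x) :
    GromovBoundary X :=
  Quot.mk _ ⟨x, hx⟩

theorem GromovBoundary.exists_eq_mk {X : Type*} [MetricSpace X] (ξ : GromovBoundary X) :
    ∃ (x : ℕ → X) (hx : ConvergesAtInfinity x), ξ = GromovBoundary.mk x hx := by
  induction ξ using Quot.ind with
  | _ x => exact ⟨x.1, x.2, rfl⟩

/-- The four-point condition makes the relation transitive, so equality in the quotient gives
nothing beyond the relation itself. -/
theorem GromovBoundary.mk_eq_mk_iff {X : Type*} [MetricSpace X] {δ : ℝ}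
    (hδ : FourPointCondition X δ) {x y : ℕ → X} (hx : ConvergesAtInfinity x)
    (hy : ConvergesAtInfinity y) :
    GromovBoundary.mk x hx = GromovBoundary.mk y hy ↔ GromovEquiv x y := by
  have he : Equivalence fun x y : {u : ℕ → X // ConvergesAtInfinity u} => GromovEquiv x.1 y.1 :=
    ⟨fun x => x.2, fun h => h.symm, fun h h' => h.trans hδ h'⟩
  exact ⟨fun h => (he.eqvGen_iff).1 (Quot.eqvGen_exact h), fun h => Quot.sound h⟩

theorem ConvergesAtInfinity.smul {G X : Type*} [Group G] [MetricSpace X] [MulAction G X]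
    [IsIsometricSMul G X] (g : G) {x : ℕ → X} (hx : ConvergesAtInfinity x) :
    ConvergesAtInfinity fun n => g • x n :=
  GromovEquiv.smul g hx

theorem GromovBoundary.smul_mk {G X : Type*} [Group G] [MetricSpace X] [MulAction G X]
    [IsIsometricSMul G X] (g : G) {x : ℕ → X} (hx : ConvergesAtInfinity x) :
    g • GromovBoundary.mk x hx =
      GromovBoundary.mk (fun n => g • x n) (hx.smul g) := rfl

/-- Gromov products of inequivalent sequences are eventually bounded. -/
theorem FourPointCondition.exists_gromovProduct_le {X : Type*} [MetricSpace X] {δ : ℝ}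
    (hδ : FourPointCondition X δ) {x y : ℕ → X} (hx : ConvergesAtInfinity x)
    (hy : ConvergesAtInfinity y) (h : ¬ GromovEquiv x y) (o : X) :
    ∃ (K : ℝ) (N : ℕ), ∀ i ≥ N, ∀ j ≥ N, gromovProduct o (x i) (y j) ≤ K := by
  by_contra! hcon
  refine h (gromovEquiv_of_forall o fun M => ?_)
  obtain ⟨N, hN⟩ := gromovEquiv_iff.1 hx o (M + 2 * δ)
  obtain ⟨N', hN'⟩ := gromovEquiv_iff.1 hy o (M + δ)
  -- A single far-out pair with large product suffices: convergence of `x` and of `y` spreads it to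
  -- all far-out pairs, at a cost of `δ` each.
  obtain ⟨i, hi, j, hj, hij⟩ := hcon (M + 2 * δ) (max N N')
  refine ⟨max N N', fun i' hi' j' hj' => ?_⟩
  have h1 := hδ.le_add (hN i' (le_of_max_le_left hi') i (le_of_max_le_left hi)) hij.le
  have h2 := hδ.le_add (M := M + δ) (by linarith)
    (hN' j (le_of_max_le_right hj) j' (le_of_max_le_right hj'))
  linarith

/-! ### Quasimorphisms -/

/-- A quasimorphism which is large at one power of `g` tends to infinity along powers of `g`. -/
theorem tendsto_abs_pow_of_lt {H : Type*} [Group H] {β : H → ℝ} {D : ℝ}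
    (hβ : ∀ g h, |β (g * h) - β g - β h| ≤ D) {g : H} {p : ℕ} (hp : D < |β (g ^ p)|) :
    Tendsto (fun n : ℕ => |β (g ^ n)|) atTop atTop := by
  have hD : 0 ≤ D := (abs_nonneg _).trans (hβ 1 1)
  set f := g ^ p with hf
  have hfk : ∀ k : ℕ, |β (f ^ k) - k * β f| ≤ (k + 1) * D := by
    intro k
    induction k with
    | zero =>
      have := hβ 1 1
      simp only [mul_one] at this
      rw [abs_le] at this ⊢
      constructor <;> simp <;> linarith
    | succ k ih =>
      have := hβ (f ^ k) f
      rw [← pow_succ] at this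
      rw [abs_le] at *
      push_cast
      constructor <;> linarith
  have hp0 : 0 < p := by
    rcases Nat.eq_zero_or_pos p with h | h
    · rw [hf, h, pow_zero] at hp
      have := hβ 1 1
      rw [mul_one, sub_self, zero_sub, abs_neg] at this
      linarith
    · exact h
  obtain ⟨R, hR⟩ : ∃ R : ℝ, ∀ r < p, |β (g ^ r)| ≤ R := by
    obtain ⟨R, hR⟩ := ((Finset.range p).image fun r => |β (g ^ r)|).bddAbove
    exact ⟨R, fun r hr => hR (by
      simp only [Finset.coe_image, Set.mem_image]
      exact ⟨r, by simpa using hr, rfl⟩)⟩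
  -- Write `g ^ n` as a power of `f` times one of finitely many remainders; the slope `|β f| - D` is
  -- positive.
  have hlow : ∀ n : ℕ, ((n / p : ℕ) : ℝ) * (|β f| - D) - (2 * D + R) ≤ |β (g ^ n)| := by
    intro n
    have h1 : g ^ n = f ^ (n / p) * g ^ (n % p) := by
      rw [hf, ← pow_mul, ← pow_add, Nat.div_add_mod]
    have h2 := hβ (f ^ (n / p)) (g ^ (n % p))
    rw [← h1] at h2
    have h3 := hR _ (Nat.mod_lt n hp0)
    have h4 := hfk (n / p)
    have h5 : |((n / p : ℕ) : ℝ) * β f| = ((n / p : ℕ) : ℝ) * |β f| := by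
      rw [abs_mul, Nat.abs_cast]
    have h6 : |((n / p : ℕ) : ℝ) * β f| ≤
        |β (g ^ n)| + |β (g ^ n) - β (f ^ (n / p)) - β (g ^ (n % p))| +
          |β (f ^ (n / p)) - ((n / p : ℕ) : ℝ) * β f| + |β (g ^ (n % p))| := by
      rw [abs_le]
      constructor
      · linarith [neg_abs_le (β (g ^ n)), le_abs_self (β (g ^ n) - β (f ^ (n / p)) - β (g ^ (n % p))),
          le_abs_self (β (f ^ (n / p)) - ((n / p : ℕ) : ℝ) * β f), le_abs_self (β (g ^ (n % p)))]
      · linarith [le_abs_self (β (g ^ n)), neg_abs_le (β (g ^ n) - β (f ^ (n / p)) - β (g ^ (n % p))),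
          neg_abs_le (β (f ^ (n / p)) - ((n / p : ℕ) : ℝ) * β f), neg_abs_le (β (g ^ (n % p)))]
    linarith
  refine tendsto_atTop_mono hlow (tendsto_atTop_add_const_right _ _ ?_)
  exact (tendsto_natCast_atTop_atTop.comp (Nat.tendsto_div_const_atTop hp0.ne')).atTop_mul_const
    (by linarith)

/-- Finitely many unbounded quasimorphisms are simultaneously large at some group element. -/
theorem exists_forall_lt_abs {H ι : Type*} [Group H] (s : Finset ι) (β : ι → H → ℝ) (D : ι → ℝ)
    (hβ : ∀ i g h, |β i (g * h) - β i g - β i h| ≤ D i) (hub : ∀ i C, ∃ h, C < |β i h|) :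
    ∃ h, ∀ i ∈ s, D i < |β i h| := by
  classical
  induction s using Finset.induction_on with
  | empty => exact ⟨1, by simp⟩
  | insert k s hk ih =>
    obtain ⟨g, hg⟩ := ih
    have hgt : ∀ i ∈ s, Tendsto (fun n : ℕ => |β i (g ^ n)|) atTop atTop := fun i hi =>
      tendsto_abs_pow_of_lt (hβ i) (p := 1) (by simpa using hg i hi)
    by_cases hkg : ∃ p : ℕ, D k < |β k (g ^ p)|
    · obtain ⟨p, hp⟩ := hkg
      have h1 : ∀ i ∈ insert k s, ∀ᶠ n : ℕ in atTop, D i < |β i (g ^ n)| := by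
        intro i hi
        rcases Finset.mem_insert.1 hi with rfl | hi
        · exact (tendsto_abs_pow_of_lt (hβ _) hp).eventually_gt_atTop _
        · exact (hgt i hi).eventually_gt_atTop _
      obtain ⟨n, hn⟩ := ((Finset.eventually_all _).2 h1).exists
      exact ⟨_, hn⟩
    -- Here `β k` is at most `D k` in absolute value on all powers of `g`. Multiplying `g ^ n` by
    -- `h` makes `β k` large because of `h`, while for large `n` the other `β i` stay large because
    -- of `g ^ n`. The factor `3` pays for `β k (g ^ n)` and the defect, leaving more than `D k`.
    · push Not at hkg
      obtain ⟨h, hh⟩ := hub k (3 * D k)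
      have h1 : ∀ i ∈ s, ∀ᶠ n : ℕ in atTop, 2 * D i + |β i h| < |β i (g ^ n)| := fun i hi =>
        (hgt i hi).eventually_gt_atTop _
      obtain ⟨n, hn⟩ := ((Finset.eventually_all _).2 h1).exists
      have key : ∀ i, |(|β i (g ^ n)| - |β i h|)| - D i ≤ |β i (g ^ n * h)| := by
        intro i
        have h2 := hβ i (g ^ n) h
        have h3 := abs_abs_sub_abs_le_abs_sub (β i (g ^ n)) (-β i h)
        rw [abs_neg, sub_neg_eq_add] at h3
        have h4 := abs_sub_abs_le_abs_sub (β i (g ^ n) + β i h) (β i (g ^ n * h))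
        rw [abs_sub_comm, ← sub_sub] at h4
        linarith
      refine ⟨g ^ n * h, fun i hi => ?_⟩
      have h5 := key i
      rcases Finset.mem_insert.1 hi with rfl | hi
      · have := neg_abs_le (|β i (g ^ n)| - |β i h|)
        linarith [hkg n]
      · have := le_abs_self (|β i (g ^ n)| - |β i h|)
        linarith [hn i hi]

/-! ### Busemann functions -/

/-- `b` is, up to the error `C`, a Busemann function (normalised at `o`) of the boundary point
represented by `z`. -/
def IsBusemann {X : Type*} [MetricSpace X] (o : X) (z : ℕ → X) (b : X → ℝ) (C : ℝ) : Prop :=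
  ∀ w : ℕ → X, GromovEquiv w z →
    ∀ x, ∀ᶠ n in atTop, |dist x (w n) - dist o (w n) - b x| ≤ C

theorem FourPointCondition.abs_dist_sub_dist_le {X : Type*} [MetricSpace X] {δ : ℝ}
    (hδ : FourPointCondition X δ) {o x y z : X} (h : dist o x ≤ gromovProduct o y z) :
    |dist x y - dist o y - (dist x z - dist o z)| ≤ 2 * δ := by
  have h1 := hδ.le_add (le_refl (gromovProduct o x y)) ((gromovProduct_le_dist o x y).trans h)
  rw [gromovProduct_comm o y z] at h
  have h2 := hδ.le_add (le_refl (gromovProduct o x z)) ((gromovProduct_le_dist o x z).trans h)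
  unfold gromovProduct at h1 h2
  rw [abs_le]
  constructor <;> linarith

theorem FourPointCondition.exists_isBusemann {X : Type*} [MetricSpace X] {δ : ℝ}
    (hδ : FourPointCondition X δ) (o : X) {z : ℕ → X} (hz : ConvergesAtInfinity z) :
    ∃ b, IsBusemann o z b (4 * δ) := by
  choose N hN using fun x => gromovEquiv_iff.1 hz o (dist o x)
  -- One far-out term of `z` defines `b x`. Comparing it with `w n` through a later term of `z`
  -- costs `2 * δ` twice.
  refine ⟨fun x => dist x (z (N x)) - dist o (z (N x)), fun w hw x => ?_⟩
  obtain ⟨N', hN'⟩ := gromovEquiv_iff.1 hw o (dist o x)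
  filter_upwards [eventually_ge_atTop N'] with n hn
  have h1 := hδ.abs_dist_sub_dist_le (hN' n hn (max (N x) N') (le_max_right _ _))
  have h2 := hδ.abs_dist_sub_dist_le (hN x (max (N x) N') (le_max_left _ _) (N x) le_rfl)
  rw [abs_le] at *
  constructor <;> linarith

namespace IsBusemann

variable {X : Type*} [MetricSpace X] {o : X} {z : ℕ → X} {b : X → ℝ} {C : ℝ}

theorem eventually_self (h : IsBusemann o z b C) (hz : ConvergesAtInfinity z) (x : X) :
    ∀ᶠ n in atTop, |dist x (z n) - dist o (z n) - b x| ≤ C :=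
  h z hz x

theorem abs_sub_le (h : IsBusemann o z b C) (hz : ConvergesAtInfinity z) (x y : X) :
    |b x - b y| ≤ dist x y + 2 * C := by
  obtain ⟨n, hx, hy⟩ := ((h.eventually_self hz x).and (h.eventually_self hz y)).exists
  have := abs_dist_sub_le x y (z n)
  rw [abs_le] at *
  constructor <;> linarith

theorem abs_base_le (h : IsBusemann o z b C) (hz : ConvergesAtInfinity z) : |b o| ≤ C := by
  obtain ⟨n, hn⟩ := (h.eventually_self hz o).exists
  simpa using hn

theorem le_dist_add (h : IsBusemann o z b C) (hz : ConvergesAtInfinity z) (x : X) :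
    b x ≤ dist o x + 3 * C := by
  have h1 := abs_le.1 (h.abs_sub_le hz x o)
  have h2 := abs_le.1 (h.abs_base_le hz)
  rw [dist_comm]
  linarith

/-- This is the four-point condition with base point `z n` going to infinity. -/
theorem dist_add_le {δ : ℝ} (h : IsBusemann o z b C) (hz : ConvergesAtInfinity z)
    (hδ : FourPointCondition X δ) (x y w : X) :
    dist x y + b w ≤ max (dist x w + b y) (dist w y + b x) + (2 * δ + 2 * C) := by
  obtain ⟨n, ⟨hx, hy⟩, hw⟩ := (((h.eventually_self hz x).and (h.eventually_self hz y)).and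
    (h.eventually_self hz w)).exists
  have h1 := hδ (z n) x w y
  rw [abs_le] at *
  simp only [gromovProduct, dist_comm (z n)] at h1
  rcases min_le_iff.1 h1 with h1 | h1
  · linarith [le_max_left (dist x w + b y) (dist w y + b x)]
  · linarith [le_max_right (dist x w + b y) (dist w y + b x)]

theorem eventually_le_gromovProduct (h : IsBusemann o z b C) (hz : ConvergesAtInfinity z) (x : X) :
    ∀ᶠ n in atTop, (dist o x - b x - C) / 2 ≤ gromovProduct o x (z n) := by
  filter_upwards [h.eventually_self hz x] with n hn
  rw [abs_le] at hn
  unfold gromovProduct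
  linarith

theorem eventually_gromovProduct_le (h : IsBusemann o z b C) (hz : ConvergesAtInfinity z) (x : X) :
    ∀ᶠ n in atTop, gromovProduct o x (z n) ≤ (dist o x - b x + C) / 2 := by
  filter_upwards [h.eventually_self hz x] with n hn
  rw [abs_le] at hn
  unfold gromovProduct
  linarith

variable {G : Type*} [Group G] [MulAction G X] [IsIsometricSMul G X]

/-- The Busemann function is almost equivariant under the stabilizer of the boundary point. -/
theorem abs_smul_sub_le {δ : ℝ} (h : IsBusemann o z b C) (hδ : FourPointCondition X δ)
    (hz : ConvergesAtInfinity z) {g : G}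
    (hg : g ∈ MulAction.stabilizer G (GromovBoundary.mk z hz)) (x : X) :
    |b (g • x) - b (g • o) - b x| ≤ 3 * C := by
  have hg' := inv_mem hg
  rw [MulAction.mem_stabilizer_iff, GromovBoundary.smul_mk, GromovBoundary.mk_eq_mk_iff hδ] at hg'
  obtain ⟨n, ⟨h1, h2⟩, h3⟩ := (((h.eventually_self hz (g • x)).and
    (h.eventually_self hz (g • o))).and (h _ hg' x)).exists
  -- The sequence `g⁻¹ • z n` also represents the fixed point, so it computes `b x`; moving `g⁻¹`
  -- across the distance gives `b (g • x) - b (g • o)`.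
  have h4 : ∀ y, dist y (g⁻¹ • z n) = dist (g • y) (z n) := fun y => by
    rw [← dist_smul g y, smul_inv_smul]
  rw [h4, h4] at h3
  rw [abs_le] at *
  constructor <;> linarith

end IsBusemann

/-! ### A criterion for hyperbolicity -/

theorem gromovProduct_base_swap {X : Type*} [MetricSpace X] (o y w : X) :
    gromovProduct y o w = dist o y - gromovProduct o y w := by
  simp only [gromovProduct, dist_comm y o]
  ring

theorem isHyperbolicElement_inv_iff {G X : Type*} [Group G] [MetricSpace X] [MulAction G X]
    [IsIsometricSMul G X] {g : G} : IsHyperbolicElement X g⁻¹ ↔ IsHyperbolicElement X g := by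
  have h : ∀ x : X, MulAction.orbit (Subgroup.zpowers g⁻¹) x =
      MulAction.orbit (Subgroup.zpowers g) x := fun x => by rw [Subgroup.zpowers_inv]
  simp only [IsHyperbolicElement, IsEllipticElement, h, MulAction.fixedBy_inv]

/-- An element fixing a boundary point `ξ` and moving the base point far away from `ξ`, as measured
by a Busemann function, is hyperbolic. -/
theorem IsBusemann.isHyperbolicElement_of_lt {X : Type*} [MetricSpace X] {δ : ℝ} {o : X}
    {z : ℕ → X} {b : X → ℝ} (hb : IsBusemann o z b (4 * δ)) (hδ : FourPointCondition X δ)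
    (hδ0 : 0 ≤ δ) (hz : ConvergesAtInfinity z) {G : Type*} [Group G] [MulAction G X]
    [IsIsometricSMul G X] {g : G} (hg : g ∈ MulAction.stabilizer G (GromovBoundary.mk z hz))
    (hlt : 14 * δ < b (g • o)) : IsHyperbolicElement X g := by
  set x : ℕ → X := fun n => g ^ n • o with hx
  have hx0 : x 0 = o := by simp [hx]
  have hsucc : ∀ n, x (n + 1) = g • x n := fun n => by simp only [hx, pow_succ', mul_smul]
  have hadd' : ∀ n k, x (n + k) = g ^ n • x k := fun n k => by simp only [hx, pow_add, mul_smul]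
  have hbo := abs_le.1 (hb.abs_base_le hz)
  have hq : ∀ (n : ℕ) (y : X), |b (g ^ n • y) - b (x n) - b y| ≤ 3 * (4 * δ) := fun n y =>
    hb.abs_smul_sub_le hδ hz (pow_mem hg n) y
  have hstep : ∀ n, b (g • o) + b (x n) - 12 * δ ≤ b (x (n + 1)) := fun n => by
    have := abs_le.1 (hb.abs_smul_sub_le hδ hz hg (x n))
    rw [hsucc]
    linarith
  have hBlow : ∀ n : ℕ, (n : ℝ) * (b (g • o) - 12 * δ) - 4 * δ ≤ b (x n) := by
    intro n
    induction n with
    | zero => rw [hx0]; simp; linarith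
    | succ n ih =>
      have := hstep n
      push_cast
      linarith
  have hB : Tendsto (fun n => b (x n)) atTop atTop :=
    tendsto_atTop_mono hBlow (tendsto_atTop_add_const_right _ _
      (tendsto_natCast_atTop_atTop.atTop_mul_const (by linarith)))
  -- The orbit moves away from `[z]` almost as fast as it moves away from `o`. In the induction, one
  -- branch of the maximum gives the bound directly; the other uses the previous bound and needs `26
  -- * δ ≤ 2 * b (g • o)`.
  obtain ⟨K, hK⟩ : ∃ K : ℝ, ∀ n, dist o (x n) ≤ b (x n) + K := by
    refine ⟨max (dist o (g • o) - b (g • o) + 10 * δ) (4 * δ), fun n => ?_⟩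
    induction n with
    | zero =>
      rw [hx0, dist_self]
      linarith [le_max_right (dist o (g • o) - b (g • o) + 10 * δ) (4 * δ)]
    | succ n ih =>
      have h1 := hb.dist_add_le hz hδ o (x (n + 1)) (g • o)
      have h2 := hstep n
      have h3 : dist (g • o) (x (n + 1)) = dist o (x n) := by rw [hsucc, dist_smul]
      have h4 := le_max_left (dist o (g • o) - b (g • o) + 10 * δ) (4 * δ)
      rw [h3] at h1
      rcases max_cases (dist o (g • o) + b (x (n + 1))) (dist o (x n) + b o) with h | h <;>
        linarith
  have hBd : ∀ n, b (x n) - 12 * δ ≤ dist o (x n) := fun n => by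
    linarith [hb.le_dist_add hz (x n)]
  have hgp : ∀ n k, b (x n) - 18 * δ - K / 2 ≤ gromovProduct o (x n) (x (n + k)) := by
    intro n k
    have h1 : dist (x n) (x (n + k)) = dist o (x k) := by
      rw [hadd', hx, dist_smul]
    have h2 := abs_le.1 (hq n (x k))
    rw [← hadd'] at h2
    unfold gromovProduct
    linarith [hBd n, hBd (n + k), hK k]
  have hgp' : ∀ M : ℝ, ∃ N, ∀ i ≥ N, ∀ j ≥ N, M ≤ gromovProduct o (x i) (x j) := by
    intro M
    obtain ⟨N, hN⟩ := eventually_atTop.1 (hB.eventually_ge_atTop (M + 18 * δ + K / 2))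
    refine ⟨N, fun i hi j hj => ?_⟩
    rcases le_total i j with h | h
    · obtain ⟨k, rfl⟩ := Nat.exists_eq_add_of_le h
      linarith [hgp i k, hN i hi]
    · obtain ⟨k, rfl⟩ := Nat.exists_eq_add_of_le h
      rw [gromovProduct_comm]
      linarith [hgp j k, hN j hj]
  have hxc : ConvergesAtInfinity x := gromovEquiv_of_forall o hgp'
  refine ⟨fun hell => ?_, ?_⟩
  · obtain ⟨R, hR⟩ := (Metric.isBounded_iff_subset_closedBall o).1 (hell o)
    obtain ⟨n, hn⟩ := (hB.eventually_gt_atTop (R + 12 * δ)).exists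
    have h1 : x n ∈ Metric.closedBall o R :=
      hR ⟨⟨g ^ n, Subgroup.npow_mem_zpowers g n⟩, rfl⟩
    rw [Metric.mem_closedBall, dist_comm] at h1
    linarith [hBd n]
  -- By `hK`, the product of `x n` with far-out terms of `z` is at most `(K + 4 * δ) / 2`.
  have hne : ¬ GromovEquiv x z := by
    intro h
    obtain ⟨N, hN⟩ := gromovEquiv_iff.1 h o ((K + 4 * δ) / 2 + 1)
    obtain ⟨j, hj, hjN⟩ := ((hb.eventually_gromovProduct_le hz (x N)).and
      (eventually_ge_atTop N)).exists
    linarith [hN N le_rfl j hjN, hK N]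
  have hfix : MulAction.fixedBy (GromovBoundary X) g =
      {GromovBoundary.mk z hz, GromovBoundary.mk x hxc} := by
    ext ζ
    simp only [MulAction.mem_fixedBy, mem_insert_iff, mem_singleton_iff]
    constructor
    · intro hζ
      obtain ⟨w, hw, rfl⟩ := ζ.exists_eq_mk
      rw [or_iff_not_imp_left, GromovBoundary.mk_eq_mk_iff hδ, GromovBoundary.mk_eq_mk_iff hδ]
      intro hwz
      obtain ⟨K₀, N, hK₀⟩ := hδ.exists_gromovProduct_le hz hw (fun h => hwz h.symm) o
      -- North-south dynamics: the backward orbit `y` tends to `[z]`, so its products with `w` stay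
      -- bounded. Applying `g ^ n`, which fixes `[w]`, makes the products of `x n` with `w` large,
      -- whence `w` is equivalent to `x`.
      set y : ℕ → X := fun n => (g ^ n)⁻¹ • o with hy
      have hby : ∀ n, b (y n) ≤ -b (x n) + 16 * δ := fun n => by
        have := abs_le.1 (hq n (y n))
        rw [hy, smul_inv_smul] at this
        linarith
      have hyw : ∀ᶠ n in atTop, ∀ j ≥ N, gromovProduct o (y n) (w j) ≤ K₀ + δ := by
        filter_upwards [hB.eventually_gt_atTop (2 * (K₀ + δ) + 20 * δ)] with n hn j hj
        obtain ⟨i, hi, hiN⟩ := ((hb.eventually_le_gromovProduct hz (y n)).and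
          (eventually_ge_atTop N)).exists
        have h1 := hδ o (z i) (y n) (w j)
        rw [gromovProduct_comm o (z i)] at h1
        by_contra! hcon
        have h2 : K₀ + δ < min (gromovProduct o (y n) (z i)) (gromovProduct o (y n) (w j)) :=
          lt_min (by linarith [hby n, dist_nonneg (x := o) (y := y n)]) hcon
        linarith [hK₀ i hiN j hj]
      have hxw : ∀ᶠ n in atTop, ∀ᶠ j in atTop,
          dist o (x n) - max (K₀ + δ) 0 - δ ≤ gromovProduct o (x n) (w j) := by
        filter_upwards [hyw] with n hn
        have hgn : g ^ n • GromovBoundary.mk w hw = GromovBoundary.mk w hw :=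
          pow_mem (S := MulAction.stabilizer G (GromovBoundary.mk w hw)) hζ n
        rw [GromovBoundary.smul_mk, GromovBoundary.mk_eq_mk_iff hδ] at hgn
        obtain ⟨N', hN'⟩ := gromovEquiv_iff.1 hgn o (dist o (x n))
        filter_upwards [eventually_ge_atTop N, eventually_ge_atTop N'] with j hj hj'
        have h1 := hN' j hj' j hj'
        have h2 : gromovProduct o (x n) (g ^ n • w j) =
            dist o (x n) - gromovProduct o (y n) (w j) := by
          have : dist o (y n) = dist o (x n) := by
            rw [hy, hx, ← dist_smul (g ^ n), smul_inv_smul, dist_comm]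
          rw [hx, gromovProduct_smul, gromovProduct_base_swap, this]
        -- The maximum with `0` keeps `M` below `dist o (x n)`, which is all that `h1` provides.
        have h3 := hδ.le_add (M := dist o (x n) - max (K₀ + δ) 0) (o := o) (x := x n)
          (y := g ^ n • w j) (z := w j)
          (by rw [h2]; linarith [hn j hj, le_max_left (K₀ + δ) 0])
          (by linarith [le_max_right (K₀ + δ) 0])
        linarith
      refine GromovEquiv.symm (gromovEquiv_of_forall o fun M => ?_)
      obtain ⟨N₁, hN₁⟩ := hgp' (M + δ)
      obtain ⟨n, ⟨hn, hnB⟩, hnN⟩ := ((hxw.and (hB.eventually_ge_atTop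
        (M + δ + max (K₀ + δ) 0 + δ + 12 * δ))).and (eventually_ge_atTop N₁)).exists
      obtain ⟨N₂, hN₂⟩ := eventually_atTop.1 hn
      refine ⟨max N₁ N₂, fun i hi j hj => ?_⟩
      have := hδ.le_add (hN₁ i (le_of_max_le_left hi) n hnN)
        (show M + δ ≤ gromovProduct o (x n) (w j) by
          linarith [hN₂ j (le_of_max_le_right hj), hBd n])
      linarith
    · rintro (rfl | rfl)
      · exact hg
      · rw [GromovBoundary.smul_mk, GromovBoundary.mk_eq_mk_iff hδ]
        refine gromovEquiv_of_forall o fun M => ?_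
        obtain ⟨N, hN⟩ := hgp' M
        refine ⟨N, fun i hi j hj => ?_⟩
        rw [← hsucc]
        exact hN _ (by omega) j hj
  rw [hfix, encard_pair]
  rw [ne_eq, GromovBoundary.mk_eq_mk_iff hδ]
  exact fun h => hne h.symm

theorem IsBusemann.isHyperbolicElement {X : Type*} [MetricSpace X] {δ : ℝ} {o : X}
    {z : ℕ → X} {b : X → ℝ} (hb : IsBusemann o z b (4 * δ)) (hδ : FourPointCondition X δ)
    (hδ0 : 0 ≤ δ) (hz : ConvergesAtInfinity z) {G : Type*} [Group G] [MulAction G X]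
    [IsIsometricSMul G X] {g : G} (hg : g ∈ MulAction.stabilizer G (GromovBoundary.mk z hz))
    (hlt : 30 * δ < |b (g • o)|) : IsHyperbolicElement X g := by
  rcases lt_abs.1 hlt with h | h
  · exact hb.isHyperbolicElement_of_lt hδ hδ0 hz hg (by linarith)
  -- Passing to the inverse changes the sign of `b (g • o)` up to `12 * δ + 4 * δ`, hence the
  -- threshold `30 = 14 + 16`.
  · rw [← isHyperbolicElement_inv_iff]
    refine hb.isHyperbolicElement_of_lt hδ hδ0 hz (inv_mem hg) ?_
    have h1 := abs_le.1 (hb.abs_smul_sub_le hδ hz hg (g⁻¹ • o))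
    have h2 := abs_le.1 (hb.abs_base_le hz)
    rw [smul_inv_smul] at h1
    linarith

/-! ### Limit points and unboundedness on finite index subgroups -/

/-- If the limit set contains a further point besides `[z]`, then the Busemann function of `[z]` is
unbounded on the orbits of finite index subgroups. -/
theorem IsBusemann.exists_lt_abs {X : Type*} [MetricSpace X] {δ C : ℝ} {o : X}
    {z : ℕ → X} {b : X → ℝ} (hb : IsBusemann o z b C) (hδ : FourPointCondition X δ)
    (hz : ConvergesAtInfinity z) {G : Type*} [Group G] [MulAction G X]
    [IsIsometricSMul G X] (H : Subgroup G) [H.FiniteIndex] {η : GromovBoundary X}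
    (hη : η ∈ limitSet G X) (hne : η ≠ GromovBoundary.mk z hz) (M : ℝ) :
    ∃ h ∈ H, M < |b (h • o)| := by
  by_contra! hcon
  obtain ⟨o', u, hu, rfl⟩ := hη
  have hne' : ¬ GromovEquiv (fun n => u n • o') z := fun h =>
    hne ((GromovBoundary.mk_eq_mk_iff hδ hu hz).2 h)
  obtain ⟨K, N, hK⟩ := hδ.exists_gromovProduct_le hu hz hne' o
  obtain ⟨R, hR⟩ := (Set.finite_range fun q : G ⧸ H => dist (q.out⁻¹ • o') o).bddAbove
  -- Finitely many coset representatives put every `u n • o'` within `R` of the `H`-orbit of `o`, so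
  -- `b` is bounded above there. As these points go to infinity, their products with `z` become
  -- large, against `hK`.
  have hbu : ∀ n, b (u n • o') ≤ M + R + 2 * C := by
    intro n
    set q : G ⧸ H := QuotientGroup.mk (u n)⁻¹ with hq
    have hmem : u n * q.out ∈ H := by
      have : ((u n)⁻¹ : G)⁻¹ * q.out ∈ H := by
        rw [← QuotientGroup.eq, ← hq, QuotientGroup.out_eq']
      simpa using this
    have h1 := (abs_le.1 (hb.abs_sub_le hz (u n • o') ((u n * q.out) • o))).2
    have h2 : dist (u n • o') ((u n * q.out) • o) = dist (q.out⁻¹ • o') o := by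
      rw [← dist_smul (u n * q.out) (q.out⁻¹ • o'), smul_smul, mul_inv_cancel_right]
    have h3 : dist (q.out⁻¹ • o') o ≤ R := hR ⟨q, rfl⟩
    linarith [le_abs_self (b ((u n * q.out) • o)), hcon _ hmem]
  obtain ⟨N', hN'⟩ := gromovEquiv_iff.1 hu o (M + R + 3 * C + 2 * K + 1)
  set n := max N N'
  obtain ⟨j, hj, hjN⟩ := ((hb.eventually_le_gromovProduct hz (u n • o')).and
    (eventually_ge_atTop N)).exists
  have h1 := hK n (le_max_left _ _) j hjN
  have h2 := (hN' n (le_max_right _ _) n (le_max_right _ _)).trans (gromovProduct_le_dist _ _ _)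
  linarith [hbu n]

theorem smul_mem_limitSet {G X : Type*} [Group G] [MetricSpace X] [MulAction G X]
    [IsIsometricSMul G X] (g : G) {ξ : GromovBoundary X} (hξ : ξ ∈ limitSet G X) :
    g • ξ ∈ limitSet G X := by
  obtain ⟨o, u, hu, rfl⟩ := hξ
  have h : (fun n => (g * u n) • o) = fun n => g • u n • o := funext fun n => mul_smul _ _ _
  have hc : ConvergesAtInfinity fun n => (g * u n) • o := by
    rw [h]
    exact hu.smul g
  exact ⟨o, fun n => g * u n, hc,
    congrArg (Quot.mk _) (Subtype.ext (funext fun n => (mul_smul g (u n) o).symm))⟩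

/-- In a lineal or focal action some boundary point has a finite orbit and is not the only limit
point. -/
theorem exists_finite_orbit_of_lineal_or_focal {G X : Type*} [Group G] [MetricSpace X]
    [MulAction G X] [IsIsometricSMul G X] (h : IsLinealAction G X ∨ IsFocalAction G X) :
    ∃ ξ η : GromovBoundary X, (MulAction.orbit G ξ).Finite ∧ η ∈ limitSet G X ∧ η ≠ ξ := by
  rcases h with h | ⟨hinf, ξ, hξ⟩
  · obtain ⟨ξ, η, hne, heq⟩ := encard_eq_two.1 h
    have hfin : (limitSet G X).Finite := by rw [heq]; exact toFinite _
    refine ⟨ξ, η, hfin.subset ?_, by rw [heq]; simp, hne.symm⟩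
    rintro _ ⟨g, rfl⟩
    exact smul_mem_limitSet g (by rw [heq]; simp)
  · obtain ⟨η, hη, hne⟩ := hinf.exists_notMem_finite (finite_singleton ξ)
    refine ⟨ξ, η, (finite_singleton ξ).subset ?_, hη, hne⟩
    rintro _ ⟨g, rfl⟩
    exact hξ g

theorem finiteIndex_stabilizer_of_finite_orbit {G α : Type*} [Group G] [MulAction G α] {a : α}
    (h : (MulAction.orbit G a).Finite) : (MulAction.stabilizer G a).FiniteIndex := by
  refine ⟨?_⟩
  rw [MulAction.index_stabilizer]
  exact ((Set.ncard_pos h).2 (MulAction.nonempty_orbit a)).ne'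

/-- On a finite index subgroup fixing a boundary point which is not the only limit point, there is
an unbounded quasimorphism whose large values detect hyperbolic elements. -/
theorem IsGromovHyperbolic.exists_quasimorphism {G X : Type*} [Group G] [MetricSpace X]
    [MulAction G X] [IsIsometricSMul G X] (hX : IsGromovHyperbolic X) {ξ η : GromovBoundary X}
    (hη : η ∈ limitSet G X) (hne : η ≠ ξ) (H : Subgroup G) [H.FiniteIndex]
    (hH : H ≤ MulAction.stabilizer G ξ) :
    ∃ (β : H → ℝ) (D : ℝ), (∀ g h, |β (g * h) - β g - β h| ≤ D) ∧ (∀ C, ∃ h, C < |β h|) ∧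
      ∀ h, D < |β h| → IsHyperbolicElement X (h : G) := by
  obtain ⟨δ, hδ0, hδ⟩ := hX.exists_fourPointCondition
  obtain ⟨z, hz, rfl⟩ := ξ.exists_eq_mk
  obtain ⟨b, hb⟩ := hδ.exists_isBusemann (z 0) hz
  -- The defect is at most `12 * δ`; the larger `30 * δ` also serves as the hyperbolicity threshold.
  refine ⟨fun h => b ((h : G) • z 0), 30 * δ, fun g h => ?_, fun C => ?_, fun h hlt => ?_⟩
  · have := hb.abs_smul_sub_le hδ hz (hH g.2) ((h : G) • z 0)
    rw [smul_smul] at this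
    exact this.trans (by linarith)
  · obtain ⟨h, hh, hlt⟩ := hb.exists_lt_abs hδ hz H hη hne C
    exact ⟨⟨h, hh⟩, hlt⟩
  · exact hb.isHyperbolicElement hδ hδ0 hz (hH h.2) hlt

theorem mainTheorem7 {G : Type*} [Group G] (l : ℕ) (X : Fin l → Type*)
    [∀ i, MetricSpace (X i)] [∀ i, MulAction G (X i)] [∀ i, IsIsometricSMul G (X i)]
    (hX : ∀ i, IsGromovHyperbolic (X i))
    (hG : ∀ i, IsLinealAction G (X i) ∨ IsFocalAction G (X i)) :
    (simultaneouslyHyperbolic G X).Nonempty := by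
  choose ξ η hfin hη hne using fun i => exists_finite_orbit_of_lineal_or_focal (hG i)
  set H : Subgroup G := ⨅ i, MulAction.stabilizer G (ξ i)
  have : H.FiniteIndex :=
    Subgroup.finiteIndex_iInf fun i => finiteIndex_stabilizer_of_finite_orbit (hfin i)
  choose β D hβ hub hhyp using fun i =>
    (hX i).exists_quasimorphism (hη i) (hne i) H (iInf_le _ i)
  obtain ⟨h, hh⟩ := exists_forall_lt_abs Finset.univ β D hβ hub
  exact ⟨h, fun i => hhyp i h (hh i (Finset.mem_univ i))⟩
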